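/- Let $(X,\|\cdot\|)$ be a real Banach space with an unconditional (Schauder) basis $(e_i)_{i\in I}$, indexed by an arbitrary set $I$, with coordinate functionals $(e_i^*)_{i\in I}$; for $\sigma\subseteq I$ let $P_\sigma x=\sum_{i\in\sigma}e_i^*(x)e_i$. Suppose that the basis is monotone, i.e. $\|P_\sigma x\|\le\|x\|$ for all $x\in X$ and all $\sigma\subseteq I$, and that for every $x\in X$ with $\|x\|=1$ there is a finite set $\sigma\subseteq I$ with $\|P_\sigma x\|=1$. Then for every $\varepsilon>0$ there is an equivalent norm $|||\cdot|||$ on $X$ which is $C^\infty$ smooth, i.e. has continuous Fréchet derivatives of all orders on $X\setminus\{0\}$, and which $\varepsilon$-approximates $\|\cdot\|$, i.e. $$(1-\varepsilon)\|x\|\le|||x|||\le(1+\varepsilon)\|x\|\qquad\text{for all }x\in X.$$ -/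

import Mathlib

open scoped ContDiff

/-- An unconditional basis `(e_i)` is monotone if its basis projections
`P_σ x = ∑_{i ∈ σ} e_i^*(x) e_i` are contractions. It suffices to ask this for finite `σ`: for
arbitrary `σ ⊆ I`, `P_σ x` is the limit of the `P_τ x` over the finite subsets `τ` of `σ`. -/
def UnconditionalSchauderBasis.IsMonotone {I X : Type*} [NormedAddCommGroup X] [NormedSpace ℝ X]
    (b : UnconditionalSchauderBasis I ℝ X) : Prop :=
  ∀ (σ : Finset I) (x : X), ‖b.proj σ x‖ ≤ ‖x‖

/-- The seminorm `p` is an equivalent norm on `X`. -/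
def Seminorm.IsEquivalentNorm {X : Type*} [NormedAddCommGroup X] [NormedSpace ℝ X]
    (p : Seminorm ℝ X) : Prop :=
  ∃ c C : ℝ, 0 < c ∧ 0 < C ∧ ∀ x : X, c * ‖x‖ ≤ p x ∧ p x ≤ C * ‖x‖

/-- `p` has continuous Fréchet derivatives of all orders on `X \ {0}`. -/
def Seminorm.IsCInftySmooth {X : Type*} [NormedAddCommGroup X] [NormedSpace ℝ X]
    (p : Seminorm ℝ X) : Prop :=
  ContDiffOn ℝ ∞ p {x : X | x ≠ 0}

/-- `p` is an `ε`-approximation of the original norm of `X`. -/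
def Seminorm.EpsApproximates {X : Type*} [NormedAddCommGroup X] [NormedSpace ℝ X]
    (p : Seminorm ℝ X) (ε : ℝ) : Prop :=
  ∀ x : X, (1 - ε) * ‖x‖ ≤ p x ∧ p x ≤ (1 + ε) * ‖x‖

open Filter Topology

/-! Give each finite `σ` thresholds `a (2|σ|) < a (2|σ|+1)` increasing with `|σ|` inside `[(1+ε)⁻¹,
1)`, and a smooth convex `φ_σ` that vanishes below the first and exceeds 1 above the second, as a
function of `‖P_σ x‖`. The new unit ball is `{∑ φ_σ ≤ 1}`. The point is that this sum is locally
finite there (`eventually_norm_proj_le`). As `‖x‖ = ‖P_σ₀ x‖ ≤ a (2|σ₀|+1)`, every `σ` larger than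
`σ₀` is inactive near `x`. A smaller `σ` containing an `i` with tiny coordinate is inactive too,
since `P_σ x` is close to `P_{σ∖i} x`, whose threshold is strictly lower. Finitely many `σ` remain,
and the implicit function theorem makes the gauge smooth. -/

/-- A smooth convex even function on `ℝ` vanishing on `[-a, a]`, with sublevel set `{ψ ≤ 1}`
contained in `[-c, c]`. -/
theorem exists_smooth_convex_even_flat {a c : ℝ} (hac : a < c) :
    ∃ ψ : ℝ → ℝ, ContDiff ℝ ∞ ψ ∧ ConvexOn ℝ Set.univ ψ ∧ (∀ t, 0 ≤ ψ t) ∧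
      (∀ t, ψ (-t) = ψ t) ∧ (∀ t, |t| ≤ a → ψ t = 0) ∧ (∀ t, ψ t ≤ 1 → |t| ≤ c) := by
  set g : ℝ → ℝ := fun t ↦ ∫ s in (0 : ℝ)..t, expNegInvGlue s with hg
  have hcont : Continuous expNegInvGlue := (expNegInvGlue.contDiff (n := 0)).continuous
  have hderiv : ∀ t, HasDerivAt g (expNegInvGlue t) t := fun t ↦
    (hcont.integral_hasStrictDerivAt 0 t).hasDerivAt
  have hdg : deriv g = expNegInvGlue := funext fun t ↦ (hderiv t).deriv
  have hdiff : Differentiable ℝ g := fun t ↦ (hderiv t).differentiableAt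
  have hsmooth : ContDiff ℝ ∞ g :=
    contDiff_infty_iff_deriv.2 ⟨hdiff, hdg ▸ expNegInvGlue.contDiff⟩
  have hmono : Monotone g := monotone_of_deriv_nonneg hdiff fun t ↦ hdg ▸ expNegInvGlue.nonneg t
  have hconv : ConvexOn ℝ Set.univ g :=
    (hdg ▸ expNegInvGlue.monotone : Monotone (deriv g)).convexOn_univ_of_deriv hdiff
  have hzero : ∀ t ≤ 0, g t = 0 := fun t ht ↦ by
    simp only [hg]
    rw [intervalIntegral.integral_congr (g := fun _ ↦ 0), intervalIntegral.integral_zero]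
    intro s hs
    rw [Set.uIcc_of_ge ht] at hs
    exact expNegInvGlue.zero_of_nonpos hs.2
  have hnonneg : ∀ t, 0 ≤ g t := fun t ↦ by
    rcases le_total t 0 with ht | ht
    · exact (hzero t ht).ge
    · exact (hzero 0 le_rfl).ge.trans (hmono ht)
  have hpos : ∀ t, 0 < t → 0 < g t := fun t ht ↦
    intervalIntegral.intervalIntegral_pos_of_pos_on (hcont.intervalIntegrable _ _)
      (fun s hs ↦ expNegInvGlue.pos_of_pos hs.1) ht
  have hK : 0 < g (c - a) := hpos _ (sub_pos.2 hac)
  have hstrict : ∀ t, c - a < t → g (c - a) < g t := fun t ht ↦ by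
    have hle : g t - g (c - a) = ∫ s in (c - a)..t, expNegInvGlue s := by
      simp only [hg]
      rw [intervalIntegral.integral_interval_sub_left] <;> exact hcont.intervalIntegrable _ _
    have : 0 < ∫ s in (c - a)..t, expNegInvGlue s :=
      intervalIntegral.intervalIntegral_pos_of_pos_on (hcont.intervalIntegrable _ _)
        (fun s hs ↦ expNegInvGlue.pos_of_pos ((sub_pos.2 hac).trans hs.1)) ht
    linarith
  -- Shifting by `a` makes both halves flat on `[-a, a]`; the factor makes the value 1 at `|t| = c`.
  refine ⟨fun t ↦ (g (c - a))⁻¹ * (g (t - a) + g (-t - a)), ?_, ?_, ?_, ?_, ?_, ?_⟩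
  · exact contDiff_const.mul ((hsmooth.comp (by fun_prop)).add (hsmooth.comp (by fun_prop)))
  · refine ConvexOn.smul (inv_nonneg.2 hK.le) (ConvexOn.add ?_ ?_)
    · exact hconv.comp_affineMap
        ((AffineMap.id ℝ ℝ) - AffineMap.const ℝ ℝ a)
    · exact hconv.comp_affineMap
        (-(AffineMap.id ℝ ℝ) - AffineMap.const ℝ ℝ a)
  · exact fun t ↦ mul_nonneg (inv_nonneg.2 hK.le) (add_nonneg (hnonneg _) (hnonneg _))
  · intro t
    simp only [neg_neg]
    rw [add_comm]
  · intro t ht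
    have := abs_le.1 ht
    simp only
    rw [hzero (t - a) (by linarith), hzero (-t - a) (by linarith)]
    simp
  · intro t ht
    simp only at ht
    rw [inv_mul_le_iff₀ hK, mul_one] at ht
    by_contra! hlt
    rcases lt_abs.1 hlt with h | h
    · linarith [hstrict (t - a) (by linarith), hnonneg (-t - a)]
    · linarith [hstrict (-t - a) (by linarith), hnonneg (t - a)]

/-! ### Smooth convex functions and smooth gauges -/

section Normed

variable {E : Type*} [NormedAddCommGroup E] [NormedSpace ℝ E]

/-- A finite-dimensional subspace is `θ`-normed by finitely many functionals of norm at most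
one, for every `θ < 1`. -/
theorem Submodule.exists_finset_dual_norming (V : Submodule ℝ E) [FiniteDimensional ℝ V]
    {θ : ℝ} (hθ : θ < 1) :
    ∃ F : Finset (StrongDual ℝ E), (∀ f ∈ F, ‖f‖ ≤ 1) ∧
      ∀ v ∈ V, v ≠ 0 → ∃ f ∈ F, θ * ‖v‖ ≤ |f v| := by
  classical
  have hK : IsCompact ((↑) '' Metric.sphere (0 : V) 1 : Set E) :=
    (isCompact_sphere (0 : V) 1).image continuous_subtype_val
  obtain ⟨F, hF⟩ := hK.elim_finite_subcover
    (fun f : {f : StrongDual ℝ E // ‖f‖ ≤ 1} ↦ {v : E | θ < f.1 v})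
    (fun f ↦ isOpen_lt continuous_const f.1.continuous) (by
      rintro _ ⟨v, hv, rfl⟩
      have hv1 : ‖(v : E)‖ = 1 := by simpa using hv
      obtain ⟨f, hf, hfv⟩ := exists_dual_vector ℝ (v : E) (by
        exact hv1.trans_ne one_ne_zero)
      refine Set.mem_iUnion.2 ⟨⟨f, hf.le⟩, ?_⟩
      simp [hfv, hv1, hθ])
  refine ⟨F.image Subtype.val, ?_, fun v hv hv0 ↦ ?_⟩
  · intro f hf
    obtain ⟨f, -, rfl⟩ := Finset.mem_image.1 hf
    exact f.2
  · have hn : 0 < ‖v‖ := norm_pos_iff.2 hv0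
    have hmem : ‖v‖⁻¹ • v ∈ ((↑) '' Metric.sphere (0 : V) 1 : Set E) :=
      ⟨‖v‖⁻¹ • ⟨v, hv⟩, by simp [norm_smul, hn.ne'], rfl⟩
    obtain ⟨f, hf, hfv⟩ := Set.mem_iUnion₂.1 (hF hmem)
    refine ⟨f.1, Finset.mem_image_of_mem _ hf, ?_⟩
    have h1 : θ < ‖v‖⁻¹ * f.1 v := by simpa using hfv
    rw [lt_inv_mul_iff₀ hn] at h1
    rw [mul_comm]
    exact h1.le.trans (le_abs_self _)

/-- For a finite-rank operator `P`, the balls `{‖P x‖ ≤ a}` and `{‖P x‖ ≤ b}` can be separated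
by a smooth convex even function. -/
theorem ContinuousLinearMap.exists_smooth_convex_even_separating (P : E →L[ℝ] E)
    [FiniteDimensional ℝ P.toLinearMap.range] {a b : ℝ} (ha : 0 < a) (hab : a < b) :
    ∃ φ : E → ℝ, ContDiff ℝ ∞ φ ∧ ConvexOn ℝ Set.univ φ ∧ (∀ x, 0 ≤ φ x) ∧
      (∀ x, φ (-x) = φ x) ∧ (∀ x, ‖P x‖ ≤ a → φ x = 0) ∧ (∀ x, φ x ≤ 1 → ‖P x‖ ≤ b) := by
  obtain ⟨c, hac, hcb⟩ := exists_between hab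
  have hc : 0 < c := ha.trans hac
  have hb : 0 < b := hc.trans hcb
  obtain ⟨ψ, hψs, hψc, hψn, hψe, hψz, hψb⟩ := exists_smooth_convex_even_flat hac
  -- The room between `c` and `b` pays for norming only up to the factor `c / b`.
  obtain ⟨F, hF1, hFn⟩ := P.toLinearMap.range.exists_finset_dual_norming
    ((div_lt_one hb).2 hcb)
  refine ⟨fun x ↦ ∑ f ∈ F, ψ (f (P x)), ?_, ?_, ?_, ?_, ?_, ?_⟩
  · exact ContDiff.sum fun f _ ↦ hψs.comp (f.comp P).contDiff
  · have := Finset.sum_induction (fun (f : StrongDual ℝ E) (x : E) ↦ ψ (f (P x)))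
      (fun g : E → ℝ ↦ ConvexOn ℝ Set.univ g) (s := F) (fun _ _ ↦ ConvexOn.add)
      (convexOn_const 0 convex_univ)
      (fun f _ ↦ hψc.comp_linearMap (f.comp P).toLinearMap)
    convert this using 1
    ext x
    simp
  · exact fun x ↦ Finset.sum_nonneg fun f _ ↦ hψn _
  · exact fun x ↦ Finset.sum_congr rfl fun f _ ↦ by rw [map_neg, map_neg, hψe]
  · refine fun x hx ↦ Finset.sum_eq_zero fun f hf ↦ hψz _ ?_
    calc |f (P x)| ≤ ‖f‖ * ‖P x‖ := f.le_opNorm _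
      _ ≤ 1 * ‖P x‖ := by gcongr; exact hF1 f hf
      _ ≤ a := by rwa [one_mul]
  · intro x hx
    rcases eq_or_ne (P x) 0 with h0 | h0
    · rw [h0, norm_zero]; exact hb.le
    obtain ⟨f, hf, hfx⟩ := hFn (P x) ⟨x, rfl⟩ h0
    have h1 : |f (P x)| ≤ c := hψb _ ((Finset.single_le_sum
      (f := fun f ↦ ψ (f (P x))) (fun f _ ↦ hψn _) hf).trans hx)
    have h2 : c * ‖P x‖ ≤ c * b := by
      have := hfx.trans h1
      rwa [div_mul_eq_mul_div, div_le_iff₀ hb] at this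
    exact le_of_mul_le_mul_left h2 hc

/-- The gauge of a closed convex neighbourhood `D` of `0` is smooth at a point of gauge one near
which `D` is a sublevel set of a smooth convex function. -/
theorem contDiffAt_gauge_of_eventually_mem_iff [CompleteSpace E] {D : Set E}
    (hc : Convex ℝ D) (hcl : IsClosed D) (h0 : D ∈ 𝓝 0) {x : E} (hx : gauge D x = 1)
    {Φ : E → ℝ} (hs : ContDiff ℝ ∞ Φ) (hconv : ConvexOn ℝ Set.univ Φ) (hΦ0 : Φ 0 < 1)
    (hloc : ∀ᶠ y in 𝓝 x, y ∈ D ↔ Φ y ≤ 1) : ContDiffAt ℝ ∞ (gauge D) x := by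
  have hgc : Continuous (gauge D) := continuous_gauge hc h0
  have key : ∀ᶠ z in 𝓝 x, gauge D z = 1 → Φ z = 1 := by
    filter_upwards [hloc.eventually_nhds] with z hz hz1
    have hfr := (gauge_eq_one_iff_mem_frontier hc h0).1 hz1
    refine le_antisymm (hz.self_of_nhds.1 (hcl.frontier_subset hfr)) ?_
    by_contra! hlt
    refine hfr.2 (mem_interior_iff_mem_nhds.2 ?_)
    filter_upwards [hz, hs.continuous.continuousAt.eventually_lt_const hlt] with w hw hw1
    exact hw.2 hw1.le
  set G : E × ℝ → ℝ := fun v ↦ Φ (v.2 • v.1) with hG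
  have hGs : ContDiffAt ℝ ∞ G (x, 1) :=
    (hs.comp (contDiff_snd.smul contDiff_fst)).contDiffAt
  have hΦx : Φ x = 1 := key.self_of_nhds hx
  set L := fderiv ℝ G (x, 1) ∘L .inr ℝ E ℝ with hL
  have hGd : HasFDerivAt G (fderiv ℝ G (x, 1)) (x, 1) :=
    (hGs.differentiableAt (by simp)).hasFDerivAt
  have hline : HasDerivAt (fun t : ℝ ↦ Φ (t • x)) (L 1) 1 := by
    have h2 : HasDerivAt (fun t : ℝ ↦ (x, t)) ((0 : E), (1 : ℝ)) 1 :=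
      (hasDerivAt_const _ _).prodMk (hasDerivAt_id _)
    simpa [hL, Function.comp_def, hG] using hGd.comp_hasDerivAt (1 : ℝ) h2
  -- By convexity the radial derivative at `x` is at least the slope `1 - Φ 0 > 0`, so `Φ (t • y) =
  -- 1` can be solved for `t = (gauge D y)⁻¹`.
  have hL1 : L 1 ≠ 0 := by
    have hcl : ConvexOn ℝ Set.univ (fun t : ℝ ↦ Φ (t • x)) :=
      hconv.comp_linearMap (LinearMap.toSpanSingleton ℝ E x)
    have := hcl.slope_le_of_hasDerivAt (Set.mem_univ 0) (Set.mem_univ 1) one_pos hline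
    simp only [slope_def_field, zero_smul, one_smul, hΦx] at this
    intro h
    rw [h] at this
    norm_num at this
    linarith
  have hinv : L.IsInvertible :=
    ⟨ContinuousLinearEquiv.unitsEquivAut ℝ (Units.mk0 _ hL1), by ext; simp⟩
  have hne : (∞ : ℕ∞ω) ≠ 0 := by simp
  have htend : Tendsto (fun y ↦ (y, (gauge D y)⁻¹)) (𝓝 x) (𝓝 (x, 1)) := by
    refine tendsto_id.prodMk_nhds ?_
    have := (hgc.tendsto x).inv₀ (by rw [hx]; exact one_ne_zero)
    rwa [hx, inv_one] at this
  have htend' : Tendsto (fun y ↦ (gauge D y)⁻¹ • y) (𝓝 x) (𝓝 x) := by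
    have := (htend.snd_nhds).smul (tendsto_id (α := E) (x := 𝓝 x))
    simpa using this
  have hpos : ∀ᶠ y in 𝓝 x, 0 < gauge D y :=
    hgc.continuousAt.eventually_const_lt (by rw [hx]; exact one_pos)
  have heq : (fun y ↦ (hGs.implicitFunction hne hinv y)⁻¹) =ᶠ[𝓝 x] gauge D := by
    filter_upwards [htend.eventually (hGs.eventually_apply_eq_iff_implicitFunction hne hinv),
      htend'.eventually key, hpos] with y hy hk hp
    have h1 : gauge D ((gauge D y)⁻¹ • y) = 1 := by
      rw [gauge_smul_of_nonneg (inv_nonneg.2 hp.le), smul_eq_mul, inv_mul_cancel₀ hp.ne']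
    rw [hy.1 (by simp [hG, hk h1, hΦx]), inv_inv]
  refine ContDiffAt.congr_of_eventuallyEq ?_ heq.symm
  refine (hGs.contDiffAt_implicitFunction hne hinv).inv ?_
  have := hGs.implicitFunction_apply_self hne hinv
  simp only at this
  rw [this]
  exact one_ne_zero

/-- A smooth norm obtained as the gauge of `{x | ∑ᵢ φᵢ x ≤ 1}`, for smooth convex even functions
`φᵢ ≥ 0` that are locally finite on this set. -/
theorem exists_seminorm_isCInftySmooth_of_locallyFinite [CompleteSpace E] {ι : Type*}
    (φ : ι → E → ℝ) (hs : ∀ i, ContDiff ℝ ∞ (φ i)) (hconv : ∀ i, ConvexOn ℝ Set.univ (φ i))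
    (hn : ∀ i x, 0 ≤ φ i x) (he : ∀ i x, φ i (-x) = φ i x) {r R : ℝ} (hr : 0 < r) (hR : 0 < R)
    (hzero : ∀ i x, ‖x‖ ≤ r → φ i x = 0) (hbd : ∀ x, (∀ i, φ i x ≤ 1) → ‖x‖ ≤ R)
    (hfin : ∀ x, (∀ i, φ i x ≤ 1) → ∃ S : Finset ι, ∀ᶠ y in 𝓝 x, ∀ i ∉ S, φ i y = 0) :
    ∃ p : Seminorm ℝ E, p.IsCInftySmooth ∧ ∀ x, R⁻¹ * ‖x‖ ≤ p x ∧ p x ≤ r⁻¹ * ‖x‖ := by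
  classical
  set Ψ : Finset ι → E → ℝ := fun S x ↦ ∑ i ∈ S, φ i x with hΨ
  have hΨs : ∀ S, ContDiff ℝ ∞ (Ψ S) := fun S ↦ ContDiff.sum fun i _ ↦ hs i
  have hΨc : ∀ S, ConvexOn ℝ Set.univ (Ψ S) := fun S ↦ by
    have := Finset.sum_induction φ (fun g : E → ℝ ↦ ConvexOn ℝ Set.univ g) (s := S)
      (fun _ _ ↦ ConvexOn.add) (convexOn_const 0 convex_univ) (fun i _ ↦ hconv i)
    convert this using 1
    ext x
    simp [hΨ]
  -- Bounding all finite partial sums avoids any question of convergence and makes `D` an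
  -- intersection of closed convex sets.
  set D : Set E := {x | ∀ S, Ψ S x ≤ 1} with hD
  have hDeq : D = ⋂ S, {x | Ψ S x ≤ 1} := by ext; simp [hD]
  have hDc : Convex ℝ D := by
    rw [hDeq]
    exact convex_iInter fun S ↦ by simpa using (hΨc S).convex_le 1
  have hDcl : IsClosed D := by
    rw [hDeq]
    exact isClosed_iInter fun S ↦ isClosed_le (hΨs S).continuous continuous_const
  have hball : Metric.closedBall 0 r ⊆ D := fun x hx S ↦ by
    simp only [hΨ]
    rw [Finset.sum_eq_zero fun i _ ↦ hzero i x (by simpa using hx)]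
    exact zero_le_one
  have hD0 : D ∈ 𝓝 0 := mem_of_superset (Metric.closedBall_mem_nhds 0 hr) hball
  have hDle : ∀ x ∈ D, ∀ i, φ i x ≤ 1 := fun x hx i ↦ by simpa [hΨ] using hx {i}
  have hDabs : Absorbent ℝ D := absorbent_nhds_zero hD0
  have hDbd : D ⊆ Metric.closedBall 0 R := fun x hx ↦ by simpa using hbd x (hDle x hx)
  have hDsymm : ∀ x ∈ D, -x ∈ D := fun x hx S ↦ by simpa [hΨ, he] using hx S
  have hlow : ∀ x, R⁻¹ * ‖x‖ ≤ gauge D x := fun x ↦ by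
    have := le_gauge_of_subset_closedBall hDabs hR.le hDbd (x := x)
    rwa [div_eq_inv_mul] at this
  have hup : ∀ x, gauge D x ≤ r⁻¹ * ‖x‖ := fun x ↦ by
    have := gauge_mono (absorbent_nhds_zero (Metric.closedBall_mem_nhds 0 hr)) hball x
    rwa [gauge_closedBall hr.le, div_eq_inv_mul] at this
  have hsphere : ∀ x, gauge D x = 1 → ContDiffAt ℝ ∞ (gauge D) x := by
    intro x hx
    have hxD : x ∈ D := by
      have := (gauge_le_one_iff_mem_closure hDc hD0).1 hx.le
      rwa [hDcl.closure_eq] at this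
    obtain ⟨S, hS⟩ := hfin x (hDle x hxD)
    refine contDiffAt_gauge_of_eventually_mem_iff hDc hDcl hD0 hx (hΨs S) (hΨc S) ?_ ?_
    · simp only [hΨ]
      rw [Finset.sum_eq_zero fun i _ ↦ hzero i 0 (by simpa using hr.le)]
      exact one_pos
    · filter_upwards [hS] with y hy
      refine ⟨fun h ↦ h S, fun h S' ↦ le_trans ?_ h⟩
      have h1 : Ψ (S' ∪ S) y = Ψ S y := (Finset.sum_subset Finset.subset_union_right
        fun i _ hi ↦ hy i hi).symm
      rw [← h1]
      exact Finset.sum_le_sum_of_subset_of_nonneg Finset.subset_union_left fun i _ _ ↦ hn i y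
  refine ⟨gaugeSeminorm (𝕜 := ℝ) (s := D) ?_ hDc hDabs, fun x hx ↦ ?_, fun x ↦ ⟨hlow x, hup x⟩⟩
  · exact (balanced_iff_neg_mem hDc).2 fun {x} hx ↦ hDsymm x hx
  · have hg : 0 < gauge D x :=
      (mul_pos (inv_pos.2 hR) (norm_pos_iff.2 hx)).trans_le (hlow x)
    have h1 : gauge D ((gauge D x)⁻¹ • x) = 1 := by
      rw [gauge_smul_of_nonneg (inv_nonneg.2 hg.le), smul_eq_mul, inv_mul_cancel₀ hg.ne']
    have h2 : ContDiffAt ℝ ∞ (fun y ↦ gauge D x * gauge D ((gauge D x)⁻¹ • y)) x :=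
      contDiffAt_const.mul
        (ContDiffAt.comp x (g := gauge D) (hsphere _ h1) (contDiffAt_id.const_smul _))
    refine ContDiffAt.contDiffWithinAt (h2.congr_of_eventuallyEq (Eventually.of_forall fun y ↦ ?_))
    change gauge D y = gauge D x * gauge D ((gauge D x)⁻¹ • y)
    rw [gauge_smul_of_nonneg (inv_nonneg.2 hg.le), smul_eq_mul, mul_inv_cancel_left₀ hg.ne']

end Normed

theorem exists_strictMono_lt_one {a : ℝ} (ha : a < 1) :
    ∃ u : ℕ → ℝ, StrictMono u ∧ u 0 = a ∧ ∀ n, u n < 1 := by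
  refine ⟨fun n ↦ 1 - (1 - a) * (1 / 2) ^ n, fun m n hmn ↦ ?_, by simp, fun n ↦ ?_⟩
  · have := pow_lt_pow_right_of_lt_one₀ (a := (1 / 2 : ℝ)) (by norm_num) (by norm_num) hmn
    have := mul_lt_mul_of_pos_left this (sub_pos.2 ha)
    simp only
    linarith
  · have : 0 < (1 - a) * (1 / 2 : ℝ) ^ n := mul_pos (sub_pos.2 ha) (by positivity)
    simp only
    linarith

/-! ### Local finiteness from the basis -/

section Basis

variable {I X : Type*} [NormedAddCommGroup X] [NormedSpace ℝ X]
  (b : UnconditionalSchauderBasis I ℝ X)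

theorem UnconditionalSchauderBasis.exists_proj_norm_eq
    (h : ∀ x : X, ‖x‖ = 1 → ∃ σ : Finset I, ‖b.proj σ x‖ = 1) (x : X) :
    ∃ σ : Finset I, ‖b.proj σ x‖ = ‖x‖ := by
  rcases eq_or_ne x 0 with rfl | hx
  · exact ⟨∅, by simp⟩
  have hn : 0 < ‖x‖ := norm_pos_iff.2 hx
  obtain ⟨σ, hσ⟩ := h (‖x‖⁻¹ • x) (by simp [norm_smul, hn.ne'])
  refine ⟨σ, ?_⟩
  rw [map_smul, norm_smul, norm_inv, norm_norm, inv_mul_eq_one₀ hn.ne'] at hσ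
  exact hσ.symm

theorem UnconditionalSchauderBasis.finite_le_norm_coord_smul (x : X) {τ : ℝ} (hτ : 0 < τ) :
    {i | τ ≤ ‖b.coord i x • b i‖}.Finite := by
  have := (b.expansion x).summable.tendsto_cofinite_zero.norm
  rw [norm_zero] at this
  simpa using (this.eventually_lt_const hτ)

/-- If `‖P_σ x‖ ≤ a (2 |σ| + 1)` for all `σ`, with `a` strictly increasing, then near `x` only
finitely many `σ` satisfy `a (2 |σ|) < ‖P_σ y‖`. -/
theorem UnconditionalSchauderBasis.eventually_norm_proj_le (hb : b.IsMonotone)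
    (h : ∀ x : X, ‖x‖ = 1 → ∃ σ : Finset I, ‖b.proj σ x‖ = 1) {a : ℕ → ℝ} (ha : StrictMono a)
    {x : X} (hx : ∀ σ : Finset I, ‖b.proj σ x‖ ≤ a (2 * σ.card + 1)) :
    ∃ S : Finset (Finset I), ∀ᶠ y in 𝓝 x, ∀ σ ∉ S, ‖b.proj σ y‖ ≤ a (2 * σ.card) := by
  classical
  obtain ⟨σ₀, hσ₀⟩ := exists_proj_norm_eq b h x
  have hxlt : ‖x‖ < a (2 * σ₀.card + 2) := hσ₀ ▸ (hx σ₀).trans_lt (ha (Nat.lt_succ_self _))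
  -- One `τ` pays for the deleted coordinate, the other for `‖y - x‖`; `m` will be `|σ| - 1`.
  obtain ⟨τ, hτ, hτpos⟩ : ∃ τ : ℝ, (∀ m ≤ σ₀.card, τ + τ < a (2 * m + 2) - a (2 * m + 1)) ∧
      0 < τ := by
    have : ∀ᶠ τ in 𝓝[>] (0 : ℝ), ∀ m ∈ Set.Iic σ₀.card,
        τ + τ < a (2 * m + 2) - a (2 * m + 1) := by
      refine (eventually_all_finite (Set.finite_Iic _)).2 fun m _ ↦ ?_
      refine Tendsto.eventually_lt_const (sub_pos.2 (ha (Nat.lt_succ_self _)))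
        (f := fun τ : ℝ ↦ τ + τ) (tendsto_nhdsWithin_of_tendsto_nhds ?_)
      exact Continuous.tendsto' (by fun_prop) _ _ (by simp)
    exact (this.and self_mem_nhdsWithin).exists
  have hfin := finite_le_norm_coord_smul b x hτpos
  refine ⟨hfin.toFinset.powerset, ?_⟩
  filter_upwards [continuous_norm.continuousAt.eventually_lt_const hxlt,
    Metric.ball_mem_nhds x hτpos] with y hy hyx σ hσ
  rcases lt_or_ge σ₀.card σ.card with hlt | hle
  · exact (hb σ y).trans (hy.le.trans (ha.monotone (by omega)))
  · rw [Finset.mem_powerset, Finset.not_subset] at hσ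
    obtain ⟨i, hi, hiS⟩ := hσ
    rw [Set.Finite.mem_toFinset, Set.mem_ofPred_eq, not_le] at hiS
    have hcard : (σ.erase i).card + 1 = σ.card := Finset.card_erase_add_one hi
    have hsplit : b.proj σ y = b.proj (σ.erase i) x + b.coord i x • b i + b.proj σ (y - x) := by
      have : b.proj σ x = b.proj (σ.erase i) x + b.coord i x • b i := by
        simp only [GeneralSchauderBasis.proj_apply]
        exact (Finset.sum_erase_add σ _ hi).symm
      rw [map_sub, ← this]
      abel
    have h1 := hx (σ.erase i)
    have h2 := hτ (σ.erase i).card (by omega)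
    have h3 : ‖b.proj σ (y - x)‖ < τ := (hb σ _).trans_lt (mem_ball_iff_norm.1 hyx)
    have h4 := norm_add₃_le (a := b.proj (σ.erase i) x) (b := b.coord i x • b i)
      (c := b.proj σ (y - x))
    rw [hsplit, ← hcard, mul_add, mul_one]
    linarith

end Basis

theorem mainTheorem4 {I X : Type*} [NormedAddCommGroup X] [NormedSpace ℝ X] [CompleteSpace X]
    (b : UnconditionalSchauderBasis I ℝ X) (hb : b.IsMonotone)
    (h : ∀ x : X, ‖x‖ = 1 → ∃ σ : Finset I, ‖b.proj σ x‖ = 1)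
    (ε : ℝ) (hε : 0 < ε) :
    ∃ p : Seminorm ℝ X, p.IsEquivalentNorm ∧ p.IsCInftySmooth ∧ p.EpsApproximates ε := by
  have hε1 : 0 < 1 + ε := by linarith
  obtain ⟨a, hmono, ha0, ha1⟩ := exists_strictMono_lt_one
    (inv_lt_one_of_one_lt₀ (by linarith : 1 < 1 + ε))
  have hpos : ∀ n, 0 < a n := fun n ↦
    (ha0 ▸ inv_pos.2 hε1 : 0 < a 0).trans_le (hmono.monotone n.zero_le)
  have hfd : ∀ σ : Finset I, FiniteDimensional ℝ (b.proj σ).toLinearMap.range := fun σ ↦ by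
    rw [GeneralSchauderBasis.range_proj_eq_span]
    exact FiniteDimensional.span_of_finite ℝ (σ.finite_toSet.image _)
  choose φ hs hconv hn he hz hbd using fun σ : Finset I ↦
    (b.proj σ).exists_smooth_convex_even_separating (hpos (2 * σ.card))
      (hmono (Nat.lt_succ_self (2 * σ.card)))
  obtain ⟨p, hp, hple⟩ := exists_seminorm_isCInftySmooth_of_locallyFinite φ hs hconv hn he
    (hpos 0) one_pos
    (fun σ x hx ↦ hz σ x ((hb σ x).trans (hx.trans (hmono.monotone (Nat.zero_le _)))))
    (fun x hx ↦ by
      obtain ⟨σ, hσ⟩ := UnconditionalSchauderBasis.exists_proj_norm_eq b h x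
      exact hσ ▸ (hbd σ x (hx σ)).trans (ha1 _).le)
    (fun x hx ↦ by
      obtain ⟨S, hS⟩ := UnconditionalSchauderBasis.eventually_norm_proj_le b hb h hmono
        fun σ ↦ hbd σ x (hx σ)
      exact ⟨S, hS.mono fun y hy σ hσ ↦ hz σ y (hy σ hσ)⟩)
  -- The radii `a 0 = (1 + ε)⁻¹` and `1` give the constants `1 + ε` and `1`.
  simp only [inv_one, ha0, inv_inv] at hple
  refine ⟨p, ⟨1, 1 + ε, one_pos, hε1, hple⟩, hp, fun x ↦ ⟨le_trans ?_ (hple x).1, (hple x).2⟩⟩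
  gcongr
  linarith
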